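/- Let $0<r<2$ and let $G=\{G(x),\,x\in\mathbb R\}$ be a fractional Brownian motion with $\sigma^2(h)=|h|^r$, that is, a mean-zero real-valued Gaussian process with almost surely continuous paths such that $$E\,(G(x+h)-G(x))^2=\sigma^2(h)=|h|^r\qquad\text{for all } x,h\in\mathbb R$$ (the normalization $G(0)=0$ is not needed). Let $1\le p<\infty$ and let $\eta$ be a normal random variable with mean zero and variance one. Then, almost surely, for all $a,b\in\mathbb R$ simultaneously, $$\lim_{h\to 0}\int_a^b\left|\frac{G(x+h)-G(x)}{\sigma(h)}\right|^p dx=E|\eta|^p\,(b-a),$$ where $\sigma(h)=|h|^{r/2}$ and $h\to0$ through nonzero real values of both signs. -/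

import Mathlib

open MeasureTheory ProbabilityTheory Filter Topology

/-- The normalised `L^p` modulus integral
`I_f(h; a, b, p) = ∫_a^b |(f(x+h) - f(x)) / σ(h)|^p dx` of a path `f : ℝ → ℝ`. -/
noncomputable def lpModulusIntegral (σ : ℝ → ℝ) (f : ℝ → ℝ) (a b p h : ℝ) : ℝ :=
  ∫ x in a..b, |(f (x + h) - f x) / σ h| ^ p

/-- Fractional Brownian motion on the line with `σ²(h) = |h|^r`: a mean zero Gaussian process
with almost surely continuous paths whose increments satisfy
`E (G(x+h) - G(x))² = |h|^r` for all `x` and `h`. For a mean zero Gaussian process this says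
in particular that the increments are stationary. The usual normalisation `G(0) = 0` is not
required, so processes which satisfy it are included. -/
structure IsFractionalBrownianMotion {Ω : Type*} [MeasurableSpace Ω] (P : Measure Ω)
    (r : ℝ) (G : ℝ → Ω → ℝ) : Prop where
  gaussian : IsGaussianProcess G P
  mean_zero : ∀ x : ℝ, ∫ ω, G x ω ∂P = 0
  increment_variance : ∀ x h : ℝ, ∫ ω, (G (x + h) ω - G x ω) ^ 2 ∂P = |h| ^ r
  continuous_paths : ∀ᵐ ω ∂P, Continuous fun x : ℝ => G x ω

/-!
Write `X_x = (G(x + h) - G(x)) / σ(h)`, a standard normal variable, and `m = E|η|^p`. The modulus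
integral `I(h)` over `[a, b]` has mean `m (b - a)`, and the proof is a second-moment argument along
a sequence of lags followed by interpolation.

*Variance.* Two jointly Gaussian standard normal variables with covariance `ρ` have `p`-th absolute
powers with covariance `O(|ρ|)` (`exists_covariance_abs_rpow_le`). For increments over intervals of
length `|h|` at distance `|x - y| ≥ |h|`, the covariance `ρ` is a second difference of `|·|^r`, so
`|ρ| ≤ (|h| / |x - y|)^(2 - r)`; this is where `r < 2` enters. Integrating over `[a, b]^2` gives
`Var I(h) = O(√|h| + √|h|^(2 - r))`
(`IsFractionalBrownianMotion.exists_variance_lpModulusIntegral_le`). Along the lags `±n^(-k)` with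
`k` large the variances are summable, hence `I(±n^(-k)) → m (b - a)` almost surely.

*Interpolation.* The paths are locally `β`-Hölder for every `β < r / 2`
(`IsFractionalBrownianMotion.ae_exists_holder`). Since consecutive lags `n^(-k)` differ by
`O(n^(-k-1))`, a `β` with `(k + 1) β > k r / 2` makes the increments between them negligible
relative to `σ(n^(-k)) = n^(-k r / 2)`, so convergence extends to all lags
(`tendsto_lpModulusIntegral_of_tendsto_seq`).

*Endpoints.* The integrals over `[0, t]` are monotone in `t` and their limit is continuous in `t`,
so the exceptional null set can be chosen from rational endpoints only
(`tendsto_lpModulusIntegral_of_rat`).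
-/

/-! ### Elementary inequalities and Gaussian covariances -/

/-- Both bounds come from Bernoulli's inequality with exponent `r / 2 ≤ 1`: squares of
`(1 ± v)^(r/2) ≤ 1 ± (r/2) v` bound the sum above, and `((1 + v)(1 - v))^(r/2) ≥ 1 - v^2` together
with the inequality of arithmetic and geometric means bounds it below. -/
lemma abs_rpow_second_difference_le {r : ℝ} (hr0 : 0 ≤ r) (hr2 : r ≤ 2) {v : ℝ} (hv : |v| ≤ 1) :
    |(1 + v) ^ r + (1 - v) ^ r - 2| ≤ 2 * v ^ 2 := by
  obtain ⟨hv1, hv2⟩ := abs_le.mp hv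
  have hp : 0 ≤ 1 + v := by linarith
  have hm : 0 ≤ 1 - v := by linarith
  have hv3 : v ^ 2 ≤ 1 := by nlinarith
  have sq (z : ℝ) (hz : 0 ≤ z) : z ^ r = (z ^ (r / 2)) ^ 2 := by
    rw [← Real.rpow_natCast, ← Real.rpow_mul hz]; norm_num
  have h1 : (1 + v) ^ (r / 2) ≤ 1 + r / 2 * v :=
    rpow_one_add_le_one_add_mul_self hv1 (by linarith) (by linarith)
  have h2 : (1 - v) ^ (r / 2) ≤ 1 - r / 2 * v := by
    have := rpow_one_add_le_one_add_mul_self (s := -v) (p := r / 2) (by linarith) (by linarith)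
      (by linarith)
    simpa [sub_eq_add_neg] using this
  have n1 : 0 ≤ (1 + v) ^ (r / 2) := Real.rpow_nonneg hp _
  have n2 : 0 ≤ (1 - v) ^ (r / 2) := Real.rpow_nonneg hm _
  have h3 : 1 - v ^ 2 ≤ (1 + v) ^ (r / 2) * (1 - v) ^ (r / 2) := by
    rw [← Real.mul_rpow hp hm, show (1 + v) * (1 - v) = 1 - v ^ 2 by ring]
    calc 1 - v ^ 2 = (1 - v ^ 2) ^ (1 : ℝ) := (Real.rpow_one _).symm
      _ ≤ _ := Real.rpow_le_rpow_of_exponent_ge' (by linarith) (by nlinarith [sq_nonneg v])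
          (by linarith) (by linarith)
  rw [sq _ hp, sq _ hm, abs_le]
  constructor
  · nlinarith [sq_nonneg ((1 + v) ^ (r / 2) - (1 - v) ^ (r / 2))]
  · have e1 := pow_le_pow_left₀ n1 h1 2
    have e2 := pow_le_pow_left₀ n2 h2 2
    have : r ^ 2 ≤ 4 := by nlinarith
    nlinarith [sq_nonneg v]

lemma abs_rpow_sub_rpow_le {p : ℝ} (hp : 1 ≤ p) {u v : ℝ} (hu : 0 ≤ u) (hv : 0 ≤ v) :
    |u ^ p - v ^ p| ≤ p * |u - v| * (max u v) ^ (p - 1) := by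
  wlog h : v ≤ u generalizing u v
  · rw [abs_sub_comm, abs_sub_comm u, max_comm]
    exact this hv hu (le_of_not_ge h)
  rw [max_eq_left h, abs_of_nonneg (sub_nonneg.mpr (Real.rpow_le_rpow hv h (by linarith))),
    abs_of_nonneg (sub_nonneg.mpr h)]
  rcases hu.eq_or_lt with rfl | hu'
  · have : v = 0 := le_antisymm h hv
    subst this; simp
  have hb := one_add_mul_self_le_rpow_one_add (s := v / u - 1)
    (by have := div_nonneg hv hu; linarith) hp
  rw [add_sub_cancel, Real.div_rpow hv hu] at hb
  have hup : 0 < u ^ p := Real.rpow_pos_of_pos hu' _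
  have h2 : u ^ p = u * u ^ (p - 1) := by
    rw [Real.rpow_sub_one hu'.ne']; field_simp
  rw [le_div_iff₀ hup] at hb
  have h3 : (1 + p * (v / u - 1)) * u ^ p = u ^ p + p * (v - u) * u ^ (p - 1) := by
    rw [h2]; field_simp
  rw [h3] at hb
  linarith

/-- The absolute moment of order `q` of the standard normal distribution. -/
noncomputable def stdGaussianAbsMoment (q : ℝ) : ℝ := ∫ y : ℝ, |y| ^ q ∂(gaussianReal 0 1)

lemma stdGaussianAbsMoment_nonneg (q : ℝ) : 0 ≤ stdGaussianAbsMoment q :=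
  integral_nonneg fun _ => Real.rpow_nonneg (abs_nonneg _) _

section Gaussian
variable {Ω : Type*} [MeasurableSpace Ω] {P : Measure Ω}

lemma integrable_abs_rpow_of_hasGaussianLaw {X : Ω → ℝ} (hX : HasGaussianLaw X P) {q : ℝ}
    (hq : 0 < q) : Integrable (fun ω => |X ω| ^ q) P := by
  have := (hX.memLp (p := ENNReal.ofReal q) ENNReal.ofReal_ne_top).integrable_norm_rpow
    (by simpa using hq) ENNReal.ofReal_ne_top
  simpa [ENNReal.toReal_ofReal hq.le] using this

lemma integral_abs_rpow_of_map_eq {X : Ω → ℝ} (hX : AEMeasurable X P)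
    (hm : P.map X = gaussianReal 0 1) (q : ℝ) :
    ∫ ω, |X ω| ^ q ∂P = stdGaussianAbsMoment q := by
  rw [stdGaussianAbsMoment, ← hm, integral_map hX]
  exact (measurable_id.abs.pow_const q).aestronglyMeasurable

lemma integral_eq_zero_of_map_eq {X : Ω → ℝ} (hX : AEMeasurable X P)
    (hm : P.map X = gaussianReal 0 1) : ∫ ω, X ω ∂P = 0 := by
  have := integral_map hX (f := fun y : ℝ => y) (by fun_prop)
  rw [← this, hm, integral_id_gaussianReal]

lemma integral_sq_eq_one_of_map_eq {X : Ω → ℝ} (hX : HasGaussianLaw X P)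
    (hm : P.map X = gaussianReal 0 1) : ∫ ω, X ω ^ 2 ∂P = 1 := by
  have : IsProbabilityMeasure P := hX.isProbabilityMeasure
  have h := variance_eq_sub hX.memLp_two
  have h2 : Var[X; P] = 1 := by
    have := variance_map (X := fun y : ℝ => y) (by fun_prop) hX.aemeasurable
    rw [hm, variance_fun_id_gaussianReal] at this
    exact_mod_cast this.symm
  rw [h2, integral_eq_zero_of_map_eq hX.aemeasurable hm] at h
  simpa using h.symm

lemma abs_integral_mul_le_one_of_map_eq {X Y : Ω → ℝ} (hX : HasGaussianLaw X P)
    (hY : HasGaussianLaw Y P) (hX1 : P.map X = gaussianReal 0 1)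
    (hY1 : P.map Y = gaussianReal 0 1) : |∫ ω, X ω * Y ω ∂P| ≤ 1 := by
  have iXY : Integrable (fun ω => X ω * Y ω) P := hX.memLp_two.integrable_mul hY.memLp_two
  have iX2 : Integrable (fun ω => X ω ^ 2) P := hX.memLp_two.integrable_sq
  have iY2 : Integrable (fun ω => Y ω ^ 2) P := hY.memLp_two.integrable_sq
  calc |∫ ω, X ω * Y ω ∂P| ≤ ∫ ω, |X ω * Y ω| ∂P := abs_integral_le_integral_abs
    _ ≤ ∫ ω, (X ω ^ 2 + Y ω ^ 2) / 2 ∂P := by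
        refine integral_mono iXY.abs ((iX2.add iY2).div_const 2) fun ω => ?_
        simp only [abs_mul]
        nlinarith [sq_nonneg (|X ω| - |Y ω|), sq_abs (X ω), sq_abs (Y ω)]
    _ = 1 := by
        rw [integral_div, integral_add iX2 iY2, integral_sq_eq_one_of_map_eq hX hX1,
          integral_sq_eq_one_of_map_eq hY hY1]
        norm_num

lemma memLp_two_abs_rpow_of_hasGaussianLaw {X : Ω → ℝ} (hX : HasGaussianLaw X P) {p : ℝ}
    (hp : 0 < p) : MemLp (fun ω => |X ω| ^ p) 2 P := by
  rw [memLp_two_iff_integrable_sq (hX.aemeasurable.abs.pow_const p).aestronglyMeasurable]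
  refine (integrable_abs_rpow_of_hasGaussianLaw hX (q := 2 * p) (by linarith)).congr
    (ae_of_all _ fun ω => ?_)
  simp only
  rw [mul_comm, Real.rpow_mul (abs_nonneg _)]
  norm_num

/-- For jointly Gaussian standard normal variables, the covariance of the `p`-th absolute powers
is controlled linearly by the covariance `ρ` of the variables. Indeed `W = Y - ρ X` is independent
of `X`, so `|Y|^p` may be replaced by `|Y|^p - |W|^p`, which is of order `ρ`. -/
lemma exists_covariance_abs_rpow_le {p : ℝ} (hp : 1 ≤ p) : ∃ K : ℝ, 0 ≤ K ∧
    ∀ X Y : Ω → ℝ, HasGaussianLaw (fun ω => (X ω, Y ω)) P →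
      P.map X = gaussianReal 0 1 → P.map Y = gaussianReal 0 1 →
      |∫ ω, (|X ω| ^ p - stdGaussianAbsMoment p) * (|Y ω| ^ p - stdGaussianAbsMoment p) ∂P|
        ≤ K * |∫ ω, X ω * Y ω ∂P| := by
  set m := stdGaussianAbsMoment p with hm
  have hm0 : 0 ≤ m := stdGaussianAbsMoment_nonneg p
  have hp0 : 0 < p := by linarith
  have hb (q : ℝ) : 0 ≤ (2 : ℝ) ^ q := by positivity
  refine ⟨p * (2 ^ (2 * p) * (2 * stdGaussianAbsMoment (2 * p)) + m * (2 ^ p * (2 * m))),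
    by have := stdGaussianAbsMoment_nonneg (2 * p); positivity, fun X Y hXY hX1 hY1 => ?_⟩
  have : IsProbabilityMeasure P := hXY.isProbabilityMeasure
  have hX := hXY.fst
  have hY := hXY.snd
  have hXm := hX.aemeasurable
  have hYm := hY.aemeasurable
  have EX := integral_eq_zero_of_map_eq hXm hX1
  have VX := integral_sq_eq_one_of_map_eq hX hX1
  set ρ := ∫ ω, X ω * Y ω ∂P with hρ
  have iXY : Integrable (fun ω => X ω * Y ω) P := hX.memLp_two.integrable_mul hY.memLp_two
  have iX2 : Integrable (fun ω => X ω ^ 2) P := hX.memLp_two.integrable_sq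
  have hρ1 : |ρ| ≤ 1 := abs_integral_mul_le_one_of_map_eq hX hY hX1 hY1
  set W : Ω → ℝ := fun ω => Y ω - ρ * X ω with hW
  have hXW : HasGaussianLaw (fun ω => (X ω, W ω)) P :=
    hXY.map_fun ((ContinuousLinearMap.fst ℝ ℝ ℝ).prod
      (ContinuousLinearMap.snd ℝ ℝ ℝ - ρ • ContinuousLinearMap.fst ℝ ℝ ℝ))
  have hWg := hXW.snd
  have hind : IndepFun X W P := by
    refine hXW.indepFun_of_covariance_eq_zero ?_
    rw [covariance_eq_sub hX.memLp_two hWg.memLp_two, EX, zero_mul, sub_zero]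
    have : (X * W) = fun ω => X ω * Y ω - ρ * X ω ^ 2 := by
      funext ω; simp only [Pi.mul_apply, hW]; ring
    rw [this, integral_sub iXY (iX2.const_mul ρ), integral_const_mul, VX]
    ring
  have mf : Measurable fun y : ℝ => |y| ^ p - m := (measurable_id.abs.pow_const p).sub_const m
  have ifX := integrable_abs_rpow_of_hasGaussianLaw hX hp0
  have zero : ∫ ω, (|X ω| ^ p - m) * (|W ω| ^ p - m) ∂P = 0 := by
    have h := (hind.comp mf mf).integral_mul_eq_mul_integral
      (mf.comp_aemeasurable hXm).aestronglyMeasurable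
      (mf.comp_aemeasurable hWg.aemeasurable).aestronglyMeasurable
    have h2 : ∫ ω, ((fun y : ℝ => |y| ^ p - m) ∘ X) ω ∂P = 0 := by
      simp only [Function.comp]
      rw [integral_sub ifX (integrable_const _), integral_abs_rpow_of_map_eq hXm hX1]
      simp [hm]
    rw [h2, zero_mul] at h
    exact h
  have sqc (Z : Ω → ℝ) (hZ : HasGaussianLaw Z P) : MemLp (fun ω => |Z ω| ^ p - m) 2 P :=
    (memLp_two_abs_rpow_of_hasGaussianLaw hZ hp0).sub (memLp_const m)
  have key : ∫ ω, (|X ω| ^ p - m) * (|Y ω| ^ p - m) ∂P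
      = ∫ ω, (|X ω| ^ p - m) * (|Y ω| ^ p - |W ω| ^ p) ∂P := by
    have i1 : Integrable (fun ω => (|X ω| ^ p - m) * (|Y ω| ^ p - m)) P :=
      (sqc X hX).integrable_mul (sqc Y hY)
    have i2 : Integrable (fun ω => (|X ω| ^ p - m) * (|W ω| ^ p - m)) P :=
      (sqc X hX).integrable_mul (sqc W hWg)
    rw [← sub_zero (∫ ω, (|X ω| ^ p - m) * (|Y ω| ^ p - m) ∂P), ← zero, ← integral_sub i1 i2]
    refine integral_congr_ae (ae_of_all _ fun ω => ?_)
    simp only; ring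
  have iX (q : ℝ) (hq : 0 < q) := integrable_abs_rpow_of_hasGaussianLaw hX hq
  have iY (q : ℝ) (hq : 0 < q) := integrable_abs_rpow_of_hasGaussianLaw hY hq
  have iM (q : ℝ) (hq : 0 < q) : Integrable (fun ω => 2 ^ q * (|X ω| ^ q + |Y ω| ^ q)) P :=
    ((iX q hq).add (iY q hq)).const_mul _
  have sumpow (q : ℝ) (hq : 0 < q) (x y : ℝ) (hx : 0 ≤ x) (hy : 0 ≤ y) :
      (x + y) ^ q ≤ 2 ^ q * (x ^ q + y ^ q) := by
    have h1 : x + y ≤ 2 * max x y := by linarith [le_max_left x y, le_max_right x y]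
    calc (x + y) ^ q ≤ (2 * max x y) ^ q := Real.rpow_le_rpow (by positivity) h1 hq.le
      _ = 2 ^ q * (max x y) ^ q := Real.mul_rpow (by norm_num) (le_max_of_le_left hx)
      _ ≤ _ := by
        refine mul_le_mul_of_nonneg_left ?_ (hb q)
        have := Real.rpow_nonneg hx q
        have := Real.rpow_nonneg hy q
        rcases max_choice x y with h | h <;> rw [h] <;> linarith
  rw [key]
  calc |∫ ω, (|X ω| ^ p - m) * (|Y ω| ^ p - |W ω| ^ p) ∂P|
      ≤ ∫ ω, p * |ρ| * (2 ^ (2 * p) * (|X ω| ^ (2 * p) + |Y ω| ^ (2 * p))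
          + m * (2 ^ p * (|X ω| ^ p + |Y ω| ^ p))) ∂P := by
        rw [← Real.norm_eq_abs]
        refine norm_integral_le_of_norm_le
          (((iM _ (by linarith)).add ((iM _ hp0).const_mul m)).const_mul _)
          (ae_of_all _ fun ω => ?_)
        have hx := abs_nonneg (X ω)
        have hy := abs_nonneg (Y ω)
        set M := |X ω| + |Y ω| with hM
        have hM0 : 0 ≤ M := by positivity
        have h1 : |(|X ω| ^ p - m)| ≤ M ^ p + m := by
          have a1 : |X ω| ^ p ≤ M ^ p := Real.rpow_le_rpow hx (by linarith) hp0.le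
          have a2 := Real.rpow_nonneg hx p
          rw [abs_le]; constructor <;> linarith
        have hWle : |W ω| ≤ M := by
          calc |W ω| ≤ |Y ω| + |ρ * X ω| := abs_sub _ _
            _ ≤ M := by
              rw [abs_mul]; nlinarith
        have h2 : |(|Y ω| ^ p - |W ω| ^ p)| ≤ p * |ρ| * M ^ p := by
          have b1 : |(|Y ω| - |W ω|)| ≤ |ρ| * M := by
            calc |(|Y ω| - |W ω|)| ≤ |Y ω - W ω| := abs_abs_sub_abs_le_abs_sub _ _
              _ = |ρ| * |X ω| := by rw [← abs_mul]; congr 1; simp only [hW]; ring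
              _ ≤ _ := by gcongr; linarith
          have b2 : max |Y ω| |W ω| ^ (p - 1) ≤ M ^ (p - 1) :=
            Real.rpow_le_rpow (le_max_of_le_left hy) (max_le (by linarith) hWle) (by linarith)
          have b3 : M ^ p = M * M ^ (p - 1) := by
            rcases hM0.eq_or_lt with h | h
            · rw [← h, Real.zero_rpow hp0.ne', zero_mul]
            · rw [Real.rpow_sub_one h.ne']; field_simp
          calc _ ≤ p * |(|Y ω| - |W ω|)| * max |Y ω| |W ω| ^ (p - 1) :=
                abs_rpow_sub_rpow_le hp hy (abs_nonneg _)
            _ ≤ p * (|ρ| * M) * M ^ (p - 1) := by gcongr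
            _ = _ := by rw [b3]; ring
        have hMp : 0 ≤ M ^ p := Real.rpow_nonneg hM0 p
        have h3 : M ^ p * M ^ p = M ^ (2 * p) := by
          rw [mul_comm 2 p, Real.rpow_mul hM0]; norm_num; ring
        rw [Real.norm_eq_abs, abs_mul]
        calc _ ≤ (M ^ p + m) * (p * |ρ| * M ^ p) :=
              mul_le_mul h1 h2 (abs_nonneg _) (by positivity)
          _ = p * |ρ| * (M ^ (2 * p) + m * M ^ p) := by rw [← h3]; ring
          _ ≤ _ := by
            gcongr
            · exact sumpow _ (by linarith) _ _ hx hy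
            · exact sumpow _ hp0 _ _ hx hy
    _ = _ := by
        have hp2 : 0 < 2 * p := by linarith
        rw [integral_const_mul, integral_add (iM _ hp2) ((iM _ hp0).const_mul m),
          integral_const_mul, integral_const_mul, integral_const_mul,
          integral_add (iX _ hp2) (iY _ hp2), integral_add (iX _ hp0) (iY _ hp0)]
        simp only [integral_abs_rpow_of_map_eq hXm hX1, integral_abs_rpow_of_map_eq hYm hY1]
        rw [← hm]; ring
end Gaussian

/-! ### The variance of the modulus integral -/

section FBM
variable {Ω : Type*} [MeasurableSpace Ω] {P : Measure Ω} {r : ℝ} {G : ℝ → Ω → ℝ}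

/-- A fractional Brownian motion agrees almost surely, at all times simultaneously, with one that
is measurable at each time and all of whose paths are continuous. -/
lemma IsFractionalBrownianMotion.exists_measurable_continuous_version
    (hG : IsFractionalBrownianMotion P r G) :
    ∃ H : ℝ → Ω → ℝ, IsFractionalBrownianMotion P r H ∧ (∀ ω, Continuous fun x => H x ω) ∧
      (∀ x, Measurable (H x)) ∧ ∀ᵐ ω ∂P, ∀ x, H x ω = G x ω := by
  classical
  -- Discarding a measurable null set leaves paths that are continuous and, at rational times,
  -- given by measurable functions; measurability at other times follows by taking limits.
  have hae : ∀ᵐ ω ∂P, (Continuous fun x => G x ω) ∧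
      ∀ q : ℚ, G q ω = (hG.gaussian.aemeasurable (q : ℝ)).mk (G q) ω :=
    hG.continuous_paths.and (ae_all_iff.mpr fun q => (hG.gaussian.aemeasurable (q : ℝ)).ae_eq_mk)
  obtain ⟨A, hAsub, hAmeas, hAnull⟩ := exists_measurable_superset_of_null hae
  set H : ℝ → Ω → ℝ := fun x ω => if ω ∈ A then 0 else G x ω with hH
  have hgood : ∀ ω, ω ∉ A → (Continuous fun x => G x ω) ∧
      ∀ q : ℚ, G q ω = (hG.gaussian.aemeasurable (q : ℝ)).mk (G q) ω := fun ω hω => by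
    by_contra hc; exact hω (hAsub hc)
  have hHG : ∀ᵐ ω ∂P, ∀ x, H x ω = G x ω := by
    have : ∀ᵐ ω ∂P, ω ∉ A := measure_eq_zero_iff_ae_notMem.mp hAnull
    filter_upwards [this] with ω hω x using if_neg hω
  have hcont : ∀ ω, Continuous fun x => H x ω := fun ω => by
    by_cases hω : ω ∈ A
    · simpa [hH, hω] using continuous_const
    · simpa [hH, hω] using (hgood ω hω).1
  have hHx (x : ℝ) : H x =ᵐ[P] G x := hHG.mono fun ω h => h x
  have hrat (q : ℚ) : Measurable (H q) := by
    have : H q = fun ω => if ω ∈ A then 0 else (hG.gaussian.aemeasurable (q : ℝ)).mk (G q) ω := by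
      funext ω
      by_cases hω : ω ∈ A
      · simp [hH, hω]
      · simpa [hH, hω] using (hgood ω hω).2 q
    rw [this]
    exact Measurable.ite hAmeas measurable_const
      (hG.gaussian.aemeasurable (q : ℝ)).measurable_mk
  refine ⟨H, ⟨hG.gaussian.congr fun x => (hHx x).symm, fun x => ?_, fun x h => ?_,
    ae_of_all _ hcont⟩, hcont, fun x => ?_, hHG⟩
  · rw [integral_congr_ae (hHx x), hG.mean_zero]
  · rw [← hG.increment_variance x h]
    refine integral_congr_ae ?_
    filter_upwards [hHG] with ω hω
    rw [hω, hω]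
  · obtain ⟨u, hu, hux⟩ := mem_closure_iff_seq_limit.mp (Rat.denseRange_cast (𝕜 := ℝ) x)
    choose q hq using hu
    refine measurable_of_tendsto_metrizable (f := fun n => H (u n)) (fun n => ?_)
      (tendsto_pi_nhds.mpr fun ω => (hcont ω).continuousAt.tendsto.comp hux)
    rw [← hq n]
    exact hrat (q n)

/-- The increment of the process `G` over `[x, x + h]`, divided by its standard deviation
`|h|^(r/2)`. -/
noncomputable def normalizedIncrement (r : ℝ) (G : ℝ → Ω → ℝ) (h x : ℝ) (ω : Ω) : ℝ :=
  (G (x + h) ω - G x ω) / √(|h| ^ r)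

lemma sqrt_abs_rpow_pos {h : ℝ} (hh : h ≠ 0) (r : ℝ) : 0 < √(|h| ^ r) :=
  Real.sqrt_pos.mpr (Real.rpow_pos_of_pos (abs_pos.mpr hh) r)

lemma IsFractionalBrownianMotion.hasGaussianLaw_normalizedIncrement_pair
    (hG : IsFractionalBrownianMotion P r G) (h x y : ℝ) :
    HasGaussianLaw (fun ω => (normalizedIncrement r G h x ω, normalizedIncrement r G h y ω)) P := by
  classical
  have : IsGaussianProcess (fun t => normalizedIncrement r G h t) P :=
    hG.gaussian.of_isGaussianProcess fun t => ⟨{t, t + h},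
      { toFun x := (x ⟨t + h, by simp⟩ - x ⟨t, by simp⟩) / √(|h| ^ r)
        map_add' := fun _ _ => by simp; ring
        map_smul' := fun _ _ => by simp; ring
        cont := by fun_prop }, by simp [normalizedIncrement]⟩
  exact this.hasGaussianLaw_prodMk

lemma IsFractionalBrownianMotion.hasGaussianLaw_normalizedIncrement
    (hG : IsFractionalBrownianMotion P r G) (h x : ℝ) :
    HasGaussianLaw (normalizedIncrement r G h x) P :=
  (hG.hasGaussianLaw_normalizedIncrement_pair h x x).fst

lemma IsFractionalBrownianMotion.integrable (hG : IsFractionalBrownianMotion P r G) (x : ℝ) :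
    Integrable (G x) P := (hG.gaussian.hasGaussianLaw_eval x).integrable

lemma IsFractionalBrownianMotion.map_normalizedIncrement
    (hG : IsFractionalBrownianMotion P r G) {h : ℝ} (hh : h ≠ 0) (x : ℝ) :
    P.map (normalizedIncrement r G h x) = gaussianReal 0 1 := by
  have hg := hG.hasGaussianLaw_normalizedIncrement h x
  have : IsProbabilityMeasure P := hg.isProbabilityMeasure
  have h0 : ∫ ω, normalizedIncrement r G h x ω ∂P = 0 := by
    simp only [normalizedIncrement]
    rw [integral_div, integral_sub (hG.integrable _) (hG.integrable _), hG.mean_zero,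
      hG.mean_zero]
    simp
  have h1 : Var[normalizedIncrement r G h x; P] = 1 := by
    have h2 : 0 < |h| ^ r := Real.rpow_pos_of_pos (abs_pos.mpr hh) r
    rw [variance_eq_sub hg.memLp_two, h0]
    simp only [Pi.pow_apply, normalizedIncrement, div_pow, Real.sq_sqrt h2.le]
    rw [integral_div, hG.increment_variance, div_self h2.ne']
    simp
  rw [hg.map_eq_gaussianReal, h0, h1]
  simp

/-- The covariance of the increments, by polarisation:
`2 (a - b) (c - d) = (a - d)^2 + (b - c)^2 - (a - c)^2 - (b - d)^2`. -/
lemma IsFractionalBrownianMotion.integral_normalizedIncrement_mul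
    (hG : IsFractionalBrownianMotion P r G) (h x y : ℝ) :
    ∫ ω, normalizedIncrement r G h x ω * normalizedIncrement r G h y ω ∂P =
      (|x - y + h| ^ r + |x - y - h| ^ r - 2 * |x - y| ^ r) / (2 * |h| ^ r) := by
  have hi (s t : ℝ) : Integrable (fun ω => (G s ω - G t ω) ^ 2) P :=
    (hG.gaussian.hasGaussianLaw_fun_sub (s := s) (t := t)).memLp_two.integrable_sq
  have hv (s t : ℝ) : ∫ ω, (G s ω - G t ω) ^ 2 ∂P = |s - t| ^ r := by
    rw [← hG.increment_variance t (s - t)]; simp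
  have hs : √(|h| ^ r) ^ 2 = |h| ^ r := Real.sq_sqrt (Real.rpow_nonneg (abs_nonneg h) r)
  have : ∀ ω, normalizedIncrement r G h x ω * normalizedIncrement r G h y ω =
      ((G (x + h) ω - G y ω) ^ 2 + (G x ω - G (y + h) ω) ^ 2
        - ((G (x + h) ω - G (y + h) ω) ^ 2 + (G x ω - G y ω) ^ 2)) / (2 * |h| ^ r) := by
    intro ω
    rw [normalizedIncrement, normalizedIncrement, div_mul_div_comm, ← sq, hs,
      mul_comm 2, ← div_div, div_right_comm]
    congr 1; ring
  simp_rw [this]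
  have hi2 (s t s' t' : ℝ) :
      Integrable (fun ω => (G s ω - G t ω) ^ 2 + (G s' ω - G t' ω) ^ 2) P :=
    (hi s t).add (hi s' t')
  rw [integral_div, integral_sub (hi2 _ _ _ _) (hi2 _ _ _ _),
    integral_add (hi _ _) (hi _ _), integral_add (hi _ _) (hi _ _)]
  simp only [hv]
  rw [show x + h - y = x - y + h by ring, show x - (y + h) = x - y - h by ring,
    show x + h - (y + h) = x - y by ring]
  congr 1; ring

lemma IsFractionalBrownianMotion.abs_integral_normalizedIncrement_mul_le
    (hG : IsFractionalBrownianMotion P r G) (hr0 : 0 < r) (hr2 : r < 2) {h x y : ℝ} (hh : h ≠ 0)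
    (hxy : |h| ≤ |x - y|) :
    |∫ ω, normalizedIncrement r G h x ω * normalizedIncrement r G h y ω ∂P| ≤
      (|h| / |x - y|) ^ (2 - r) := by
  rw [hG.integral_normalizedIncrement_mul]
  set s := x - y
  have hh' : 0 < |h| := abs_pos.mpr hh
  have hs' : 0 < |s| := hh'.trans_le hxy
  have hs : s ≠ 0 := abs_pos.mp hs'
  have hhr : 0 < |h| ^ r := Real.rpow_pos_of_pos hh' r
  have hsr : 0 < |s| ^ r := Real.rpow_pos_of_pos hs' r
  have hv : |h / s| ≤ 1 := by rw [abs_div]; exact (div_le_one hs').mpr hxy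
  obtain ⟨hv1, hv2⟩ := abs_le.mp hv
  have key := abs_rpow_second_difference_le hr0.le hr2.le hv
  have e1 : |s + h| ^ r = |s| ^ r * (1 + h / s) ^ r := by
    rw [← Real.mul_rpow hs'.le (by linarith), ← abs_of_nonneg (by linarith : 0 ≤ 1 + h / s),
      ← abs_mul]
    congr 2; field_simp
  have e2 : |s - h| ^ r = |s| ^ r * (1 - h / s) ^ r := by
    rw [← Real.mul_rpow hs'.le (by linarith), ← abs_of_nonneg (by linarith : 0 ≤ 1 - h / s),
      ← abs_mul]
    congr 2; field_simp
  have e3 : (|s + h| ^ r + |s - h| ^ r - 2 * |s| ^ r) / (2 * |h| ^ r) =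
      (|s| ^ r / (2 * |h| ^ r)) * ((1 + h / s) ^ r + (1 - h / s) ^ r - 2) := by
    rw [e1, e2]; ring
  have e4 : (|h| / |s|) ^ (2 - r) = (|s| ^ r / (2 * |h| ^ r)) * (2 * (h / s) ^ 2) := by
    rw [Real.rpow_sub (by positivity), Real.div_rpow hh'.le hs'.le r, ← sq_abs (h / s),
      abs_div, Real.rpow_two]
    field_simp
  rw [e3, e4, abs_mul, abs_of_pos (by positivity : 0 < |s| ^ r / (2 * |h| ^ r))]
  exact mul_le_mul_of_nonneg_left key (by positivity)

lemma volume_prod_restrict_Ioc_abs_sub_le {a b ε : ℝ} (hab : a ≤ b) (hε : 0 ≤ ε) :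
    ((volume.restrict (Set.Ioc a b)).prod (volume.restrict (Set.Ioc a b))).real
      {q : ℝ × ℝ | |q.1 - q.2| ≤ ε} ≤ 2 * ε * (b - a) := by
  have hS : MeasurableSet {q : ℝ × ℝ | |q.1 - q.2| ≤ ε} :=
    measurableSet_le (by fun_prop) measurable_const
  rw [Measure.real, Measure.prod_apply hS]
  refine ENNReal.toReal_le_of_le_ofReal (mul_nonneg (by positivity) (sub_nonneg.mpr hab)) ?_
  calc _ ≤ ∫⁻ _ in Set.Ioc a b, ENNReal.ofReal (2 * ε) := by
        refine lintegral_mono fun x => ?_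
        refine (Measure.restrict_apply_le _ _).trans ?_
        rw [← Real.volume_closedBall x]
        refine measure_mono fun y hy => ?_
        simpa [Real.dist_eq, abs_sub_comm] using hy
    _ = _ := by
        rw [lintegral_const, Measure.restrict_apply_univ, Real.volume_Ioc,
          ENNReal.ofReal_mul (by positivity : 0 ≤ 2 * ε)]

/-- The second moment of the integral of a process with constant second moment is the double
integral of its second-moment kernel. -/
lemma integral_sq_integral_eq_integral_prod [IsProbabilityMeasure P] {α : Type*}
    [MeasurableSpace α] {μ : Measure α} [IsFiniteMeasure μ] {Z : α → Ω → ℝ}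
    (hZu : Measurable (Function.uncurry Z)) (hZ2 : ∀ x, MemLp (Z x) 2 P) {V : ℝ}
    (hZV : ∀ x, ∫ ω, Z x ω ^ 2 ∂P = V) :
    Integrable (fun ω => (∫ x, Z x ω ∂μ) ^ 2) P ∧
      Integrable (fun q : α × α => ∫ ω, Z q.1 ω * Z q.2 ω ∂P) (μ.prod μ) ∧
      ∫ ω, (∫ x, Z x ω ∂μ) ^ 2 ∂P = ∫ q : α × α, ∫ ω, Z q.1 ω * Z q.2 ω ∂P ∂(μ.prod μ) := by
  have hZZ (x y : α) : Integrable (fun ω => Z x ω * Z y ω) P := (hZ2 x).integrable_mul (hZ2 y)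
  have hdev (ω : Ω) : (∫ x, Z x ω ∂μ) ^ 2 = ∫ q : α × α, Z q.1 ω * Z q.2 ω ∂(μ.prod μ) := by
    rw [integral_prod_mul (fun x => Z x ω) (fun y => Z y ω), ← sq]
  set F : Ω × (α × α) → ℝ := fun z => Z z.2.1 z.1 * Z z.2.2 z.1 with hF
  have hFm : Measurable F := by
    have h1 : Measurable fun z : Ω × (α × α) => Z z.2.1 z.1 :=
      hZu.comp (measurable_snd.fst.prodMk measurable_fst)
    have h2 : Measurable fun z : Ω × (α × α) => Z z.2.2 z.1 :=
      hZu.comp (measurable_snd.snd.prodMk measurable_fst)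
    exact h1.mul h2
  have hFi : Integrable F (P.prod (μ.prod μ)) := by
    rw [integrable_prod_iff' hFm.aestronglyMeasurable]
    refine ⟨ae_of_all _ fun q => hZZ q.1 q.2, ?_⟩
    refine (integrable_const V).mono' ?_ (ae_of_all _ fun q => ?_)
    · exact hFm.norm.stronglyMeasurable.integral_prod_left'.aestronglyMeasurable
    · rw [Real.norm_of_nonneg (integral_nonneg fun _ => norm_nonneg _)]
      calc ∫ ω, ‖F (ω, q)‖ ∂P ≤ ∫ ω, (Z q.1 ω ^ 2 + Z q.2 ω ^ 2) / 2 ∂P := by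
            refine integral_mono (hZZ q.1 q.2).norm
              (((hZ2 q.1).integrable_sq.add (hZ2 q.2).integrable_sq).div_const 2) fun ω => ?_
            simp only [hF, Real.norm_eq_abs, abs_mul]
            nlinarith [sq_nonneg (|Z q.1 ω| - |Z q.2 ω|), sq_abs (Z q.1 ω), sq_abs (Z q.2 ω)]
        _ = V := by
            rw [integral_div, integral_add (hZ2 q.1).integrable_sq (hZ2 q.2).integrable_sq,
              hZV, hZV]
            ring
  refine ⟨?_, hFi.integral_prod_right, ?_⟩
  · simp_rw [hdev]; exact hFi.integral_prod_left
  · simp_rw [hdev]; exact integral_integral_swap (f := fun ω q => F (ω, q)) hFi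

/-- The variance of the modulus integral is `O(|h|^(1/2) + |h|^((2-r)/2))`: pairs of points at
distance at most `√|h|` fill a set of measure `O(√|h|)`, and for the other pairs the correlation of
the increments is at most `√|h|^(2-r)`. -/
lemma IsFractionalBrownianMotion.exists_variance_lpModulusIntegral_le
    (hG : IsFractionalBrownianMotion P r G) (hr0 : 0 < r) (hr2 : r < 2)
    (hcont : ∀ ω, Continuous fun x => G x ω) (hmeas : ∀ x, Measurable (G x))
    {p : ℝ} (hp : 1 ≤ p) {a b : ℝ} (hab : a ≤ b) : ∃ C : ℝ, ∀ h : ℝ, h ≠ 0 → |h| ≤ 1 →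
      Integrable (fun ω => (lpModulusIntegral (fun u => √(|u| ^ r)) (fun x => G x ω) a b p h
        - stdGaussianAbsMoment p * (b - a)) ^ 2) P ∧
      ∫ ω, (lpModulusIntegral (fun u => √(|u| ^ r)) (fun x => G x ω) a b p h
        - stdGaussianAbsMoment p * (b - a)) ^ 2 ∂P ≤ C * (√|h| + √|h| ^ (2 - r)) := by
  have hP : IsProbabilityMeasure P := hG.gaussian.isProbabilityMeasure
  obtain ⟨K, hK0, hK⟩ := exists_covariance_abs_rpow_le (P := P) hp
  set m := stdGaussianAbsMoment p with hm
  have hp0 : 0 < p := by linarith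
  refine ⟨K * (2 * (b - a) + (b - a) ^ 2), fun h hh hh1 => ?_⟩
  set μ : Measure ℝ := volume.restrict (Set.Ioc a b) with hμ
  set N := normalizedIncrement r G h with hN
  set Z : ℝ → Ω → ℝ := fun x ω => |N x ω| ^ p - m with hZ
  have hZcont (ω : Ω) : Continuous fun x => Z x ω := by
    have : Continuous fun x => N x ω :=
      (((hcont ω).comp (continuous_id.add continuous_const)).sub (hcont ω)).div_const _
    exact (this.abs.rpow_const fun _ => Or.inr hp0.le).sub continuous_const
  have hZmeas (x : ℝ) : Measurable (Z x) :=
    ((((hmeas _).sub (hmeas _)).div_const _).abs.pow_const p).sub_const m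
  have hZu : Measurable (Function.uncurry Z) :=
    measurable_uncurry_of_continuous_of_measurable hZcont hZmeas
  have hg (x : ℝ) := hG.hasGaussianLaw_normalizedIncrement h x
  have hlaw (x : ℝ) := hG.map_normalizedIncrement hh x
  have hZ2 (x : ℝ) : MemLp (Z x) 2 P :=
    (memLp_two_abs_rpow_of_hasGaussianLaw (hg x) hp0).sub (memLp_const m)
  set V := ∫ y : ℝ, (|y| ^ p - m) ^ 2 ∂(gaussianReal 0 1) with hV
  have hZV (x : ℝ) : ∫ ω, Z x ω ^ 2 ∂P = V := by
    rw [hV, ← hlaw x, integral_map (hg x).aemeasurable]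
    exact (((measurable_id.abs.pow_const p).sub_const m).pow_const 2).aestronglyMeasurable
  have hdev (ω : Ω) : lpModulusIntegral (fun u => √(|u| ^ r)) (fun x => G x ω) a b p h
        - m * (b - a) = ∫ x, Z x ω ∂μ := by
    have i1 : IntervalIntegrable (fun x => |N x ω| ^ p) volume a b := by
      have h1 : (fun x => |N x ω| ^ p) = fun x => Z x ω + m := by simp [hZ]
      rw [h1]
      exact ((hZcont ω).add continuous_const).intervalIntegrable a b
    rw [hμ, ← intervalIntegral.integral_of_le hab, hZ,
      intervalIntegral.integral_sub i1 (by simp), intervalIntegral.integral_const, smul_eq_mul,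
      mul_comm m]
    rfl
  obtain ⟨hi1, hi2, hi3⟩ := integral_sq_integral_eq_integral_prod (μ := μ) hZu hZ2 hZV
  simp_rw [hdev]
  refine ⟨hi1, ?_⟩
  rw [hi3]
  set ε := √|h| with hε
  have hε0 : 0 < ε := Real.sqrt_pos.mpr (abs_pos.mpr hh)
  have hεsq : |h| = ε * ε := (Real.mul_self_sqrt (abs_nonneg h)).symm
  have hε1 : ε ≤ 1 := by rw [hε]; exact Real.sqrt_le_one.mpr hh1
  set S : Set (ℝ × ℝ) := {q | |q.1 - q.2| ≤ ε} with hS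
  have hSm : MeasurableSet S := measurableSet_le (by fun_prop) measurable_const
  have iS : Integrable (S.indicator fun _ => (1 : ℝ)) (μ.prod μ) :=
    (integrable_const 1).indicator hSm
  have hpos : 0 ≤ ε ^ (2 - r) := Real.rpow_nonneg hε0.le _
  calc ∫ q : ℝ × ℝ, ∫ ω, Z q.1 ω * Z q.2 ω ∂P ∂(μ.prod μ)
      ≤ ∫ q, K * (S.indicator (fun _ => (1 : ℝ)) q + ε ^ (2 - r)) ∂(μ.prod μ) := by
        refine integral_mono hi2 ((iS.add (integrable_const _)).const_mul K)
          fun q => ?_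
        refine (le_abs_self _).trans ((hK _ _
          (hG.hasGaussianLaw_normalizedIncrement_pair h q.1 q.2) (hlaw _) (hlaw _)).trans ?_)
        refine mul_le_mul_of_nonneg_left ?_ hK0
        by_cases hq : q ∈ S
        · rw [Set.indicator_of_mem hq]
          have := abs_integral_mul_le_one_of_map_eq (hg q.1) (hg q.2) (hlaw _) (hlaw _)
          linarith
        · rw [Set.indicator_of_notMem hq, zero_add]
          have hq' : ε < |q.1 - q.2| := not_le.mp hq
          refine (hG.abs_integral_normalizedIncrement_mul_le hr0 hr2 hh
            (by nlinarith)).trans ?_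
          refine Real.rpow_le_rpow (by positivity) ?_ (by linarith)
          rw [div_le_iff₀ (hε0.trans hq'), hεsq]
          gcongr
    _ = K * ((μ.prod μ).real S + ε ^ (2 - r) * (b - a) ^ 2) := by
        rw [integral_const_mul, integral_add iS (integrable_const _), integral_indicator hSm]
        have huniv : (μ.prod μ).real Set.univ = (b - a) ^ 2 := by
          rw [← Set.univ_prod_univ, measureReal_prod_prod, hμ, measureReal_restrict_apply_univ,
            Real.volume_real_Ioc_of_le hab, sq]
        rw [setIntegral_const, integral_const, huniv, smul_eq_mul, smul_eq_mul]
        ring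
    _ ≤ _ := by
        rw [mul_assoc]
        refine mul_le_mul_of_nonneg_left ?_ hK0
        have := volume_prod_restrict_Ioc_abs_sub_le hab hε0.le
        have hba := sub_nonneg.mpr hab
        nlinarith [mul_nonneg hba hpos, mul_nonneg (sq_nonneg (b - a)) hε0.le]
end FBM

/-! ### Hölder continuity of the paths -/

/-- The dyadic chaining argument: a continuous function whose increments between neighbouring
dyadic points of level `m` are at most `C (2^(-β))^m` is locally `β`-Hölder. -/
lemma exists_holder_of_dyadic {f : ℝ → ℝ} (hf : Continuous f) {β C : ℝ} (hβ : 0 < β) (hC : 0 ≤ C)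
    (N : ℕ) (hdy : ∀ m : ℕ, ∀ i ∈ Finset.Icc (-(N * 2 ^ m) : ℤ) (N * 2 ^ m),
      |f ((i + 1) / 2 ^ m) - f (i / 2 ^ m)| ≤ C * ((2 : ℝ) ^ (-β)) ^ m) :
    ∃ C' : ℝ, 0 ≤ C' ∧ ∀ x ∈ Set.Icc (-N : ℝ) N, ∀ y ∈ Set.Icc (-N : ℝ) N, |x - y| ≤ 1 →
      |f x - f y| ≤ C' * |x - y| ^ β := by
  set θ : ℝ := 2 ^ (-β) with hθ
  have hθ0 : 0 < θ := by positivity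
  have hθ1 : θ < 1 := Real.rpow_lt_one_of_one_lt_of_neg (by norm_num) (by linarith)
  -- `A θ^m` is the sum of the geometric series `∑ j ≥ m, C θ^j`.
  set A : ℝ := C / (1 - θ) with hA
  have hA0 : 0 ≤ A := div_nonneg hC (by linarith)
  have hAθ : A * (1 - θ) = C := div_mul_cancel₀ _ (by linarith)
  set fl : ℝ → ℕ → ℤ := fun x m => ⌊x * 2 ^ m⌋ with hfl
  have hmem (x : ℝ) (hx : x ∈ Set.Icc (-N : ℝ) N) (m : ℕ) :
      fl x m ∈ Finset.Icc (-(N * 2 ^ m) : ℤ) (N * 2 ^ m) := by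
    have h2 : (0 : ℝ) < 2 ^ m := by positivity
    rw [Finset.mem_Icc]
    constructor
    · rw [hfl, Int.le_floor]; push_cast; nlinarith [hx.1]
    · have : (fl x m : ℝ) ≤ x * 2 ^ m := Int.floor_le _
      have h3 : (fl x m : ℝ) ≤ N * 2 ^ m := this.trans (by nlinarith [hx.2])
      exact_mod_cast h3
  have hstep (x : ℝ) (hx : x ∈ Set.Icc (-N : ℝ) N) (m : ℕ) :
      |f (fl x (m + 1) / 2 ^ (m + 1)) - f (fl x m / 2 ^ m)| ≤ C * θ ^ m := by
    have h2 : (0 : ℝ) < 2 ^ m := by positivity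
    set j := fl x m with hj
    have hj1 : (j : ℝ) ≤ x * 2 ^ m := Int.floor_le _
    have hj2 : x * 2 ^ m < j + 1 := Int.lt_floor_add_one _
    have hcases : fl x (m + 1) = 2 * j ∨ fl x (m + 1) = 2 * j + 1 := by
      have k1 : 2 * j ≤ fl x (m + 1) := by
        rw [hfl, Int.le_floor]; push_cast; rw [pow_succ]; linarith
      have k2 : fl x (m + 1) < 2 * j + 2 := by
        rw [hfl, Int.floor_lt]; push_cast; rw [pow_succ]; linarith
      omega
    have hdouble : ((2 * j : ℤ) : ℝ) / 2 ^ (m + 1) = j / 2 ^ m := by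
      push_cast; rw [pow_succ]; field_simp
    have hpow : θ ^ (m + 1) ≤ θ ^ m := pow_le_pow_of_le_one hθ0.le hθ1.le (Nat.le_succ m)
    rcases hcases with h | h
    · rw [h, hdouble]; simp; positivity
    · have hm := hmem x hx (m + 1)
      rw [h, Finset.mem_Icc] at hm
      have hpos : (0 : ℤ) ≤ N * 2 ^ (m + 1) := by positivity
      have hN : (2 * j : ℤ) ∈ Finset.Icc (-(N * 2 ^ (m + 1)) : ℤ) (N * 2 ^ (m + 1)) := by
        have := (Finset.mem_Icc.mp (hmem x hx m)).1
        rw [Finset.mem_Icc]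
        refine ⟨?_, by omega⟩
        rw [pow_succ]; linarith
      have := hdy (m + 1) (2 * j) hN
      rw [hdouble] at this
      rw [h]
      push_cast at this ⊢
      exact this.trans (mul_le_mul_of_nonneg_left hpow hC)
  have hind (x : ℝ) (hx : x ∈ Set.Icc (-N : ℝ) N) (m n : ℕ) :
      |f (fl x (m + n) / 2 ^ (m + n)) - f (fl x m / 2 ^ m)| ≤ A * (θ ^ m - θ ^ (m + n)) := by
    induction n with
    | zero => simp
    | succ n ih =>
      calc _ ≤ |f (fl x (m + n + 1) / 2 ^ (m + n + 1)) - f (fl x (m + n) / 2 ^ (m + n))|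
            + |f (fl x (m + n) / 2 ^ (m + n)) - f (fl x m / 2 ^ m)| := abs_sub_le _ _ _
        _ ≤ C * θ ^ (m + n) + A * (θ ^ m - θ ^ (m + n)) := add_le_add (hstep x hx _) ih
        _ = _ := by rw [← hAθ, ← add_assoc, pow_succ]; ring
  have happrox (x : ℝ) (hx : x ∈ Set.Icc (-N : ℝ) N) (m : ℕ) :
      |f x - f (fl x m / 2 ^ m)| ≤ A * θ ^ m := by
    have hlim : Tendsto (fun n : ℕ => (fl x (m + n) : ℝ) / 2 ^ (m + n)) atTop (𝓝 x) := by
      have hlow : Tendsto (fun n : ℕ => x - (1 / 2 : ℝ) ^ (m + n)) atTop (𝓝 x) := by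
        have := (tendsto_pow_atTop_nhds_zero_of_lt_one (r := (1 / 2 : ℝ)) (by norm_num)
          (by norm_num)).comp (tendsto_add_atTop_nat m)
        simpa [Function.comp_def, add_comm] using this.const_sub x
      refine tendsto_of_tendsto_of_tendsto_of_le_of_le hlow tendsto_const_nhds
        (fun n => ?_) fun n => ?_
      · have h2 : (0 : ℝ) < 2 ^ (m + n) := by positivity
        rw [one_div_pow, le_div_iff₀ h2, sub_mul, one_div_mul_cancel h2.ne']
        linarith [Int.lt_floor_add_one (x * 2 ^ (m + n))]
      · exact (div_le_iff₀ (by positivity)).mpr (Int.floor_le _)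
    refine le_of_tendsto ((((hf.tendsto x).comp hlim).sub_const _).abs)
      (Eventually.of_forall fun n => (hind x hx m n).trans ?_)
    have : 0 ≤ A * θ ^ (m + n) := by positivity
    nlinarith
  have hnear (x : ℝ) (hx : x ∈ Set.Icc (-N : ℝ) N) (y : ℝ) (hy : y ∈ Set.Icc (-N : ℝ) N)
      (hxy : x ≤ y) (m : ℕ) (hm : (y - x) * 2 ^ m ≤ 1) :
      |f x - f y| ≤ (2 * A + C) * θ ^ m := by
    have h2 : (0 : ℝ) < 2 ^ m := by positivity
    have hfloor : |f (fl x m / 2 ^ m) - f (fl y m / 2 ^ m)| ≤ C * θ ^ m := by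
      have k1 : fl x m ≤ fl y m := Int.floor_le_floor (by nlinarith)
      have k2 : fl y m ≤ fl x m + 1 := by
        have : fl y m < fl x m + 2 := by
          rw [hfl, Int.floor_lt]; push_cast
          have := Int.lt_floor_add_one (x * 2 ^ m)
          linarith
        omega
      rcases (by omega : fl y m = fl x m ∨ fl y m = fl x m + 1) with h | h
      · rw [h]; simp; positivity
      · rw [h, abs_sub_comm]; push_cast
        exact hdy m _ (hmem x hx m)
    calc |f x - f y| ≤ |f x - f (fl x m / 2 ^ m)| + |f (fl x m / 2 ^ m) - f y| := abs_sub_le _ _ _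
      _ ≤ |f x - f (fl x m / 2 ^ m)| + (|f (fl x m / 2 ^ m) - f (fl y m / 2 ^ m)|
          + |f (fl y m / 2 ^ m) - f y|) := by gcongr; exact abs_sub_le _ _ _
      _ ≤ A * θ ^ m + (C * θ ^ m + A * θ ^ m) := by
          gcongr
          · exact happrox x hx m
          · rw [abs_sub_comm]; exact happrox y hy m
      _ = _ := by ring
  refine ⟨(2 * A + C) / θ, by positivity, fun x hx y hy hxy1 => ?_⟩
  wlog hxy : x ≤ y generalizing x y
  · rw [abs_sub_comm, abs_sub_comm x]
    exact this y hy x hx (by rwa [abs_sub_comm]) (le_of_not_ge hxy)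
  rcases hxy.eq_or_lt with rfl | hlt
  · simp [Real.zero_rpow hβ.ne']
  have hd : 0 < y - x := sub_pos.mpr hlt
  have habs : |x - y| = y - x := by rw [abs_sub_comm, abs_of_pos hd]
  rw [habs] at hxy1 ⊢
  obtain ⟨m, hm1, hm2⟩ := exists_nat_pow_near (one_le_inv_iff₀.mpr ⟨hd, hxy1⟩)
    (by norm_num : (1 : ℝ) < 2)
  have hm : (y - x) * 2 ^ m ≤ 1 := by
    rw [mul_comm]; exact (le_div_iff₀ hd).mp (by rwa [one_div])
  refine (hnear x hx y hy hxy m hm).trans ?_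
  have hθpow : θ ^ (m + 1) ≤ (y - x) ^ β := by
    have e1 : θ ^ (m + 1) = (((2 : ℝ) ^ (m + 1))⁻¹) ^ β := by
      rw [hθ, ← Real.rpow_natCast, ← Real.rpow_mul (by norm_num), Real.inv_rpow (by positivity),
        ← Real.rpow_natCast, ← Real.rpow_mul (by norm_num), ← Real.rpow_neg (by norm_num)]
      congr 1; ring
    rw [e1]
    exact Real.rpow_le_rpow (by positivity) (inv_le_of_inv_le₀ hd hm2.le) hβ.le
  calc (2 * A + C) * θ ^ m = (2 * A + C) / θ * θ ^ (m + 1) := by rw [pow_succ]; field_simp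
    _ ≤ _ := by gcongr

section
variable {Ω : Type*} [MeasurableSpace Ω] {P : Measure Ω}

lemma ae_tendsto_zero_of_summable_integral {Y : ℕ → Ω → ℝ} (h0 : ∀ n ω, 0 ≤ Y n ω)
    (hi : ∀ n, Integrable (Y n) P) (hs : Summable fun n => ∫ ω, Y n ω ∂P) :
    ∀ᵐ ω ∂P, Tendsto (fun n => Y n ω) atTop (𝓝 0) := by
  have hm (n : ℕ) : AEMeasurable (fun ω => ENNReal.ofReal (Y n ω)) P :=
    (hi n).aemeasurable.ennreal_ofReal
  have hfin : ∫⁻ ω, ∑' n, ENNReal.ofReal (Y n ω) ∂P ≠ ⊤ := by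
    rw [lintegral_tsum hm]
    have (n : ℕ) : ∫⁻ ω, ENNReal.ofReal (Y n ω) ∂P = ENNReal.ofReal (∫ ω, Y n ω ∂P) :=
      (ofReal_integral_eq_lintegral_ofReal (hi n) (ae_of_all _ (h0 n))).symm
    simp_rw [this]
    exact hs.tsum_ofReal_ne_top
  filter_upwards [ae_lt_top' (AEMeasurable.tsum hm) hfin] with ω hω
  have h1 := ENNReal.tendsto_atTop_zero_of_tsum_ne_top hω.ne
  have h2 := (ENNReal.tendsto_toReal ENNReal.zero_ne_top).comp h1
  refine h2.congr fun n => ?_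
  exact ENNReal.toReal_ofReal (h0 n ω)

variable {r : ℝ} {G : ℝ → Ω → ℝ}

lemma IsFractionalBrownianMotion.integral_abs_sub_rpow
    (hG : IsFractionalBrownianMotion P r G) {s t : ℝ} (hst : s ≠ t) (q : ℝ) :
    ∫ ω, |G s ω - G t ω| ^ q ∂P = stdGaussianAbsMoment q * |s - t| ^ (r * q / 2) := by
  have hh : s - t ≠ 0 := sub_ne_zero.mpr hst
  have hσ := sqrt_abs_rpow_pos hh r
  have (ω : Ω) : |G s ω - G t ω| ^ q =
      |normalizedIncrement r G (s - t) t ω| ^ q * √(|s - t| ^ r) ^ q := by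
    rw [normalizedIncrement, ← Real.mul_rpow (abs_nonneg _) hσ.le, abs_div, abs_of_pos hσ,
      div_mul_cancel₀ _ hσ.ne', add_sub_cancel]
  simp_rw [this]
  rw [integral_mul_const, integral_abs_rpow_of_map_eq
    (hG.hasGaussianLaw_normalizedIncrement _ _).aemeasurable (hG.map_normalizedIncrement hh t),
    Real.sqrt_eq_rpow, ← Real.rpow_mul (abs_nonneg _), ← Real.rpow_mul (abs_nonneg _)]
  congr 2; ring

/-- Kolmogorov's continuity criterion for fractional Brownian motion: the paths are locally
`β`-Hölder for every `β < r / 2`. -/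
lemma IsFractionalBrownianMotion.ae_exists_holder
    (hG : IsFractionalBrownianMotion P r G) {β : ℝ} (hβ : 0 < β) (hβr : β < r / 2) :
    ∀ᵐ ω ∂P, ∀ N : ℕ, ∃ C : ℝ, 0 ≤ C ∧ ∀ x ∈ Set.Icc (-N : ℝ) N, ∀ y ∈ Set.Icc (-N : ℝ) N,
      |x - y| ≤ 1 → |G x ω - G y ω| ≤ C * |x - y| ^ β := by
  rw [ae_all_iff]
  intro N
  have hd : 0 < r / 2 - β := by linarith
  -- With this `q` each of the `O(2^m)` terms at level `m` has expectation `O(4^(-m))`.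
  set q : ℝ := 2 / (r / 2 - β) with hq
  have hq0 : 0 < q := by positivity
  have hqd : q * (r / 2 - β) = 2 := div_mul_cancel₀ _ hd.ne'
  set θ : ℝ := 2 ^ (-β) with hθ
  have hθ0 : 0 < θ := by positivity
  set D : ℕ → ℤ → Ω → ℝ := fun m i ω => G ((i + 1) / 2 ^ m) ω - G (i / 2 ^ m) ω with hD
  set Y : ℕ → Ω → ℝ := fun m ω => ∑ i ∈ Finset.Icc (-(N * 2 ^ m) : ℤ) (N * 2 ^ m),
    (|D m i ω| / θ ^ m) ^ q with hY
  have hterm0 (m : ℕ) (i : ℤ) (ω : Ω) : 0 ≤ (|D m i ω| / θ ^ m) ^ q := by positivity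
  have hdiv (m : ℕ) (i : ℤ) (ω : Ω) : (|D m i ω| / θ ^ m) ^ q = |D m i ω| ^ q / (θ ^ m) ^ q :=
    Real.div_rpow (abs_nonneg _) (by positivity) _
  have hint (m : ℕ) (i : ℤ) : Integrable (fun ω => (|D m i ω| / θ ^ m) ^ q) P := by
    simp_rw [hdiv]
    exact (integrable_abs_rpow_of_hasGaussianLaw hG.gaussian.hasGaussianLaw_fun_sub hq0).div_const _
  have hval (m : ℕ) (i : ℤ) : ∫ ω, (|D m i ω| / θ ^ m) ^ q ∂P =
      stdGaussianAbsMoment q * (1 / 4) ^ m := by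
    have h2 : (0 : ℝ) < 2 ^ m := by positivity
    have hsub : ((i : ℝ) + 1) / 2 ^ m - i / 2 ^ m = (2 ^ m)⁻¹ := by field_simp; ring
    simp_rw [hdiv]
    rw [integral_div, hG.integral_abs_sub_rpow (fun h => by
      rw [← sub_eq_zero, hsub] at h; exact (inv_pos.mpr h2).ne' h), hsub, mul_div_assoc,
      abs_of_pos (inv_pos.mpr h2)]
    congr 1
    rw [hθ, show (1 / 4 : ℝ) = 2 ^ (-2 : ℝ) by rw [Real.rpow_neg (by positivity)]; norm_num,
      ← Real.rpow_natCast, ← Real.rpow_natCast, ← Real.rpow_natCast,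
      ← Real.rpow_neg (by positivity), ← Real.rpow_mul (by positivity),
      ← Real.rpow_mul (by positivity), ← Real.rpow_mul (by positivity),
      ← Real.rpow_mul (by positivity), ← Real.rpow_sub (by positivity)]
    congr 1
    linear_combination (-(m : ℝ)) * hqd
  have hYint (m : ℕ) : ∫ ω, Y m ω ∂P ≤ (2 * N + 1) * stdGaussianAbsMoment q * (1 / 2) ^ m := by
    have hM := stdGaussianAbsMoment_nonneg q
    rw [hY, integral_finsetSum _ fun i _ => hint m i]
    simp_rw [hval]
    rw [Finset.sum_const, Int.card_Icc, nsmul_eq_mul]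
    have h1 : (1 : ℝ) ≤ 2 ^ m := one_le_pow₀ (by norm_num)
    have hcard : (((N * 2 ^ m + 1 - -(N * 2 ^ m) : ℤ).toNat : ℕ) : ℝ) ≤ (2 * N + 1) * 2 ^ m := by
      have : (N * 2 ^ m + 1 - -(N * 2 ^ m) : ℤ).toNat = 2 * (N * 2 ^ m) + 1 := by
        have : (N * 2 ^ m + 1 - -(N * 2 ^ m) : ℤ) = ((2 * (N * 2 ^ m) + 1 : ℕ) : ℤ) := by
          push_cast; ring
        rw [this, Int.toNat_natCast]
      rw [this]; push_cast; nlinarith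
    have hpow : (2 : ℝ) ^ m * (1 / 4) ^ m = (1 / 2) ^ m := by rw [← mul_pow]; norm_num
    calc _ ≤ (2 * N + 1) * 2 ^ m * (stdGaussianAbsMoment q * (1 / 4) ^ m) := by gcongr
      _ = _ := by rw [← hpow]; ring
  have hY0 (m : ℕ) (ω : Ω) : 0 ≤ Y m ω := Finset.sum_nonneg fun i _ => hterm0 m i ω
  have hsum : Summable fun m => ∫ ω, Y m ω ∂P :=
    Summable.of_nonneg_of_le (fun m => integral_nonneg (hY0 m)) hYint
      ((summable_geometric_of_lt_one (by norm_num) (by norm_num)).mul_left _)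
  filter_upwards [hG.continuous_paths, ae_tendsto_zero_of_summable_integral hY0
    (fun m => integrable_finsetSum _ fun i _ => hint m i) hsum] with ω hcont hlim
  obtain ⟨S, hS⟩ := hlim.bddAbove_range
  have hS' (m : ℕ) : Y m ω ≤ S := hS (Set.mem_range_self m)
  have hS0 : 0 ≤ S := (hY0 0 ω).trans (hS' 0)
  refine exists_holder_of_dyadic hcont hβ (C := S ^ q⁻¹) (by positivity) N fun m i hi => ?_
  have h1 : (|D m i ω| / θ ^ m) ^ q ≤ S :=
    (Finset.single_le_sum (f := fun i => (|D m i ω| / θ ^ m) ^ q)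
      (fun j _ => hterm0 m j ω) hi).trans (hS' m)
  have h2 : |D m i ω| / θ ^ m ≤ S ^ q⁻¹ := by
    rw [Real.le_rpow_inv_iff_of_pos (by positivity) hS0 hq0]; exact h1
  exact (div_le_iff₀ (by positivity)).mp h2
end

/-! ### Interpolation between lags -/

lemma abs_rpow_sub_rpow_le_of_abs_sub_le {p : ℝ} (hp : 1 ≤ p) {u v e : ℝ} (hu : 0 ≤ u)
    (hv : 0 ≤ v) (huv : |u - v| ≤ e) (he : e ≤ 1) :
    |u ^ p - v ^ p| ≤ p * 2 ^ p * e * (v ^ p + 1) := by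
  have he0 : 0 ≤ e := (abs_nonneg _).trans huv
  have hmax : max u v ≤ 2 * max v 1 := by
    have := (abs_le.mp huv).2
    have h1 := le_max_left v 1
    have h2 := le_max_right v 1
    exact max_le (by linarith) (by linarith)
  have h1 : max u v ^ (p - 1) ≤ 2 ^ p * (v ^ p + 1) := by
    have hm1 : (1 : ℝ) ≤ 2 * max v 1 := by linarith [le_max_right v 1]
    calc max u v ^ (p - 1) ≤ (2 * max v 1) ^ (p - 1) :=
          Real.rpow_le_rpow (le_max_of_le_left hu) hmax (by linarith)
      _ ≤ (2 * max v 1) ^ p := Real.rpow_le_rpow_of_exponent_le hm1 (by linarith)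
      _ = 2 ^ p * max v 1 ^ p := Real.mul_rpow (by norm_num) (le_max_of_le_left hv)
      _ ≤ _ := by
        refine mul_le_mul_of_nonneg_left ?_ (by positivity)
        have := Real.rpow_nonneg hv p
        rcases max_choice v 1 with h | h <;> rw [h]
        · linarith
        · rw [Real.one_rpow]; linarith
  calc |u ^ p - v ^ p| ≤ p * |u - v| * max u v ^ (p - 1) := abs_rpow_sub_rpow_le hp hu hv
    _ ≤ p * e * (2 ^ p * (v ^ p + 1)) := by
        have : 0 ≤ max u v ^ (p - 1) := Real.rpow_nonneg (le_max_of_le_left hu) _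
        gcongr
    _ = _ := by ring

lemma inv_pow_sub_inv_pow_le {t n : ℝ} (hn : 1 ≤ n) (hnt : n ≤ t) (htn : t ≤ n + 1) (k : ℕ) :
    (n ^ k)⁻¹ - (t ^ k)⁻¹ ≤ k * 2 ^ k * (t ^ (k + 1))⁻¹ := by
  have hn0 : 0 < n := by linarith
  have ht0 : 0 < t := by linarith
  have hB : 1 - k * t⁻¹ ≤ (n / t) ^ k := by
    have h1 := one_add_mul_le_pow (a := n / t - 1)
      (by have : 0 ≤ n / t := by positivity
          linarith) k
    rw [add_sub_cancel] at h1
    have h2 : -t⁻¹ ≤ n / t - 1 := by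
      rw [div_sub_one ht0.ne', inv_eq_one_div, ← neg_div]
      gcongr; linarith
    nlinarith [(Nat.cast_nonneg k : (0 : ℝ) ≤ k)]
  have h3 : (t ^ k)⁻¹ = (n ^ k)⁻¹ * (n / t) ^ k := by rw [div_pow]; field_simp
  have h4 : (n ^ k)⁻¹ ≤ 2 ^ k * (t ^ k)⁻¹ := by
    have : t ^ k ≤ (2 * n) ^ k := pow_le_pow_left₀ ht0.le (by linarith) k
    rw [mul_pow] at this
    rw [inv_eq_one_div, ← div_eq_mul_inv, div_le_div_iff₀ (by positivity) (by positivity)]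
    linarith
  have h5 : 0 < (n ^ k)⁻¹ := by positivity
  calc (n ^ k)⁻¹ - (t ^ k)⁻¹ = (n ^ k)⁻¹ * (1 - (n / t) ^ k) := by rw [h3]; ring
    _ ≤ (n ^ k)⁻¹ * (k * t⁻¹) := by gcongr; linarith
    _ ≤ 2 ^ k * (t ^ k)⁻¹ * (k * t⁻¹) := by gcongr
    _ = _ := by rw [pow_succ, mul_inv]; ring

/-- For a locally `β`-Hölder path, convergence of the modulus integral along the lags
`±n^(-k)` implies convergence along all lags of that sign. With `h = t^(-k)`, neighbouring lags
differ by `O(t^(-(k+1)))`, so the change of the increment is `O(t^(-(k+1)β))`, which is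
negligible against `σ(h) = t^(-k r / 2)`. -/
lemma tendsto_lpModulusIntegral_of_tendsto_seq {g : ℝ → ℝ} (hg : Continuous g)
    {r β p c a b s : ℝ} {k : ℕ} (hab : a ≤ b) (hs : |s| = 1) (hp : 1 ≤ p) (hk : k ≠ 0)
    (hβ : 0 < β) (hkβ : k * (r / 2) < (k + 1) * β)
    (hH : ∀ N : ℕ, ∃ C : ℝ, 0 ≤ C ∧ ∀ x ∈ Set.Icc (-N : ℝ) N, ∀ y ∈ Set.Icc (-N : ℝ) N,
      |x - y| ≤ 1 → |g x - g y| ≤ C * |x - y| ^ β)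
    (hseq : Tendsto (fun n : ℕ => lpModulusIntegral (fun u => √(|u| ^ r)) g a b p
      (s * ((n : ℝ) ^ k)⁻¹)) atTop (𝓝 c)) :
    Tendsto (fun h => lpModulusIntegral (fun u => √(|u| ^ r)) g a b p (s * h)) (𝓝[>] 0)
      (𝓝 c) := by
  have hp0 : 0 < p := by linarith
  set I : ℝ → ℝ := lpModulusIntegral (fun u => √(|u| ^ r)) g a b p with hI
  suffices hmain : Tendsto (fun t : ℝ => I (s * (t ^ k)⁻¹)) atTop (𝓝 c) by
    have h1 : Tendsto (fun h : ℝ => h⁻¹ ^ ((k : ℝ)⁻¹)) (𝓝[>] 0) atTop :=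
      (tendsto_rpow_atTop (by positivity)).comp tendsto_inv_nhdsGT_zero
    refine (hmain.comp h1).congr' ?_
    filter_upwards [self_mem_nhdsWithin] with h hh
    have hh' : (0 : ℝ) ≤ h⁻¹ := inv_nonneg.mpr (Set.mem_Ioi.mp hh).le
    simp only [Function.comp]
    rw [Real.rpow_inv_natCast_pow hh' hk, inv_inv]
  obtain ⟨N, hN⟩ := exists_nat_ge (max |a| |b| + 1)
  obtain ⟨C, hC0, hC⟩ := hH N
  have hσ (t : ℝ) (ht : 0 < t) : √(|s * (t ^ k)⁻¹| ^ r) = t ^ (-(k * (r / 2))) := by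
    rw [abs_mul, hs, one_mul, abs_of_pos (by positivity), Real.sqrt_eq_rpow, ← Real.rpow_natCast,
      ← Real.rpow_neg ht.le, ← Real.rpow_mul ht.le, ← Real.rpow_mul ht.le]
    congr 1; ring
  set D : ℝ := C * (k * 2 ^ k : ℝ) ^ β with hD
  set e : ℝ → ℝ := fun t => D * t ^ (k * (r / 2) - (k + 1) * β) with he
  have he0 : Tendsto e atTop (𝓝 0) := by
    have h1 := tendsto_rpow_neg_atTop (y := (k + 1) * β - k * (r / 2)) (by linarith)
    simpa [he] using h1.const_mul D
  set ρ : ℝ → ℝ := fun t => ((⌊t⌋₊ : ℝ) / t) ^ (-(k * (r / 2))) with hρ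
  have hρ1 : Tendsto ρ atTop (𝓝 1) := by
    simpa using (tendsto_nat_floor_div_atTop (R := ℝ)).rpow_const
      (p := -(k * (r / 2))) (Or.inl one_ne_zero)
  -- `J t` is the modulus integral at the nearby lag `±⌊t⌋^(-k)`, renormalised by `σ` at the lag
  -- `±t^(-k)`.
  set J : ℝ → ℝ := fun t => I (s * ((⌊t⌋₊ : ℝ) ^ k)⁻¹) * ρ t ^ p with hJ
  have hJc : Tendsto J atTop (𝓝 c) := by
    have h1 : Tendsto (fun t => ρ t ^ p) atTop (𝓝 1) := by
      simpa using hρ1.rpow_const (p := p) (Or.inl one_ne_zero)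
    simpa using (hseq.comp (tendsto_nat_floor_atTop (α := ℝ))).mul h1
  have hbound : ∀ᶠ t in atTop, |I (s * (t ^ k)⁻¹) - J t| ≤ p * 2 ^ p * e t * (J t + (b - a)) := by
    filter_upwards [eventually_ge_atTop (1 : ℝ), he0.eventually_le_const one_pos] with t ht1 het
    have ht0 : 0 < t := by linarith
    set n : ℝ := (⌊t⌋₊ : ℝ) with hn
    have hn1 : 1 ≤ n := by
      have : 1 ≤ ⌊t⌋₊ := Nat.le_floor (by simpa using ht1)
      rw [hn]; exact_mod_cast this
    have hn0 : 0 < n := by linarith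
    have hnt : n ≤ t := Nat.floor_le ht0.le
    have htn : t ≤ n + 1 := (Nat.lt_floor_add_one t).le
    set h := s * (t ^ k)⁻¹ with hh
    set h' := s * (n ^ k)⁻¹ with hh'
    set σ := √(|h| ^ r) with hσdef
    set σ' := √(|h'| ^ r) with hσ'def
    have hσt : σ = t ^ (-(k * (r / 2))) := hσ t ht0
    have hσn : σ' = n ^ (-(k * (r / 2))) := hσ n hn0
    have hσ0 : 0 < σ := by rw [hσt]; positivity
    have hσ'0 : 0 < σ' := by rw [hσn]; positivity
    have hρt : ρ t = σ' / σ := by rw [hσt, hσn, ← Real.div_rpow hn0.le ht0.le]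
    have hlag (x : ℝ) (hx : 1 ≤ x) : |s * (x ^ k)⁻¹| ≤ 1 := by
      rw [abs_mul, hs, one_mul, abs_of_pos (by positivity)]
      exact inv_le_one_of_one_le₀ (one_le_pow₀ hx)
    have hdist : |h - h'| = (n ^ k)⁻¹ - (t ^ k)⁻¹ := by
      have h2 : (t ^ k)⁻¹ ≤ (n ^ k)⁻¹ := by gcongr
      rw [hh, hh', ← mul_sub, abs_mul, hs, one_mul, abs_sub_comm, abs_of_nonneg (by linarith)]
    have hhh : |h - h'| ≤ k * 2 ^ k * (t ^ (k + 1))⁻¹ :=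
      hdist.trans_le (inv_pow_sub_inv_pow_le hn1 hnt htn k)
    have hhh1 : |h - h'| ≤ 1 := by
      have h3 : (n ^ k)⁻¹ ≤ 1 := inv_le_one_of_one_le₀ (one_le_pow₀ hn1)
      have h4 : 0 < (t ^ k)⁻¹ := by positivity
      linarith
    set u : ℝ → ℝ := fun x => |(g (x + h) - g x) / σ| with hu
    set v : ℝ → ℝ := fun x => |(g (x + h') - g x) / σ'| * ρ t with hv
    have hρ0 : 0 ≤ ρ t := by rw [hρt]; positivity
    have huv : ∀ x ∈ Set.Icc a b, |u x - v x| ≤ e t := by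
      intro x hx
      have hxN (z : ℝ) (hz : |z| ≤ 1) : x + z ∈ Set.Icc (-N : ℝ) N := by
        have h1 : |x| ≤ max |a| |b| := abs_le_max_abs_abs hx.1 hx.2
        rw [Set.mem_Icc, ← abs_le]
        exact (abs_add_le x z).trans (by linarith)
      have hinc : |g (x + h) - g (x + h')| ≤ C * |h - h'| ^ β := by
        have := hC _ (hxN h (hlag t ht1)) _ (hxN h' (hlag n hn1)) (by simpa using hhh1)
        simpa using this
      have hv' : v x = |(g (x + h') - g x) / σ| := by
        change |(g (x + h') - g x) / σ'| * ρ t = _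
        rw [hρt, abs_div, abs_div, abs_of_pos hσ0, abs_of_pos hσ'0]
        field_simp
      rw [hv']
      calc _ ≤ |(g (x + h) - g x) / σ - (g (x + h') - g x) / σ| := abs_abs_sub_abs_le_abs_sub _ _
        _ = |g (x + h) - g (x + h')| / σ := by
            rw [← sub_div, abs_div, abs_of_pos hσ0]; congr 2; ring
        _ ≤ C * (k * 2 ^ k * (t ^ (k + 1))⁻¹) ^ β / σ := by
            gcongr
            exact hinc.trans (by gcongr)
        _ = e t := by
            rw [hσt, Real.mul_rpow (by positivity) (by positivity), he, hD, ← Real.rpow_natCast t,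
              ← Real.rpow_neg ht0.le, ← Real.rpow_mul ht0.le, mul_div_assoc, mul_div_assoc,
              ← Real.rpow_sub ht0]
            simp only [Nat.cast_add, Nat.cast_one]
            rw [mul_assoc]
            congr 3
            ring
    have hcu : Continuous fun x => u x ^ p :=
      ((((hg.comp (continuous_id.add continuous_const)).sub hg).div_const _).abs).rpow_const
        fun _ => Or.inr hp0.le
    have hcv : Continuous fun x => v x ^ p :=
      (((((hg.comp (continuous_id.add continuous_const)).sub hg).div_const _).abs).mul
        continuous_const).rpow_const fun _ => Or.inr hp0.le
    have hIu : I h = ∫ x in a..b, u x ^ p := rfl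
    have hJv : J t = ∫ x in a..b, v x ^ p := by
      have : ∀ x, v x ^ p = |(g (x + h') - g x) / σ'| ^ p * ρ t ^ p := fun x =>
        Real.mul_rpow (abs_nonneg _) hρ0
      simp_rw [this]
      rw [intervalIntegral.integral_mul_const]
      rfl
    rw [hIu, hJv, ← intervalIntegral.integral_sub (hcu.intervalIntegrable _ _)
      (hcv.intervalIntegrable _ _), ← Real.norm_eq_abs]
    have hbd : IntervalIntegrable (fun x => p * 2 ^ p * e t * (v x ^ p + 1)) volume a b :=
      (continuous_const.mul (hcv.add continuous_const)).intervalIntegrable _ _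
    refine (intervalIntegral.norm_integral_le_of_norm_le hab (ae_of_all _ fun x hx => ?_)
      hbd).trans_eq ?_
    · rw [Real.norm_eq_abs]
      exact abs_rpow_sub_rpow_le_of_abs_sub_le hp (abs_nonneg _)
        (mul_nonneg (abs_nonneg _) hρ0) (huv x ⟨hx.1.le, hx.2⟩) het
    · rw [intervalIntegral.integral_const_mul, intervalIntegral.integral_add
        (hcv.intervalIntegrable _ _) (by simp)]
      simp
  have hdiff : Tendsto (fun t => I (s * (t ^ k)⁻¹) - J t) atTop (𝓝 0) := by
    refine squeeze_zero_norm' (by simpa only [Real.norm_eq_abs] using hbound) ?_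
    simpa using (he0.const_mul (p * 2 ^ p)).mul (hJc.add_const (b - a))
  simpa using hdiff.add hJc

/-! ### Almost sure convergence -/

/-- Monotone functions that converge at every rational point to a continuous limit converge
everywhere. -/
lemma tendsto_of_monotone_of_tendsto_rat {ι : Type*} {l : Filter ι} {F : ι → ℝ → ℝ} {φ : ℝ → ℝ}
    (hF : ∀ i, Monotone (F i)) (hφ : Continuous φ)
    (h : ∀ q : ℚ, Tendsto (fun i => F i q) l (𝓝 (φ q))) (t : ℝ) :
    Tendsto (fun i => F i t) l (𝓝 (φ t)) := by
  rw [tendsto_order]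
  constructor
  · intro A hA
    have hU : {x | A < φ x} ∈ 𝓝[<] t :=
      nhdsWithin_le_nhds ((hφ.tendsto t).eventually_const_lt hA)
    obtain ⟨y, hy, hsub⟩ := mem_nhdsLT_iff_exists_Ioo_subset.mp hU
    obtain ⟨q, hq1, hq2⟩ := exists_rat_btwn (Set.mem_Iio.mp hy)
    filter_upwards [(h q).eventually_const_lt (hsub ⟨hq1, hq2⟩)] with i hi
    exact hi.trans_le (hF i hq2.le)
  · intro A hA
    have hU : {x | φ x < A} ∈ 𝓝[>] t :=
      nhdsWithin_le_nhds ((hφ.tendsto t).eventually_lt_const hA)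
    obtain ⟨y, hy, hsub⟩ := mem_nhdsGT_iff_exists_Ioo_subset.mp hU
    obtain ⟨q, hq1, hq2⟩ := exists_rat_btwn (Set.mem_Ioi.mp hy)
    filter_upwards [(h q).eventually_lt_const (hsub ⟨hq1, hq2⟩)] with i hi
    exact (hF i hq1.le).trans_lt hi

/-- The modulus integrals over `[0, t]` are monotone in `t`, so convergence for rational endpoints
gives convergence for all endpoints, in either order. -/
lemma tendsto_lpModulusIntegral_of_rat {l : Filter ℝ} {σ g : ℝ → ℝ} (hg : Continuous g) {p c : ℝ}
    (hp : 0 ≤ p)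
    (h : ∀ a b : ℚ, a ≤ b →
      Tendsto (fun h => lpModulusIntegral σ g a b p h) l (𝓝 (c * ((b : ℝ) - a)))) (a b : ℝ) :
    Tendsto (fun h => lpModulusIntegral σ g a b p h) l (𝓝 (c * (b - a))) := by
  set f : ℝ → ℝ → ℝ := fun h x => |(g (x + h) - g x) / σ h| ^ p with hf
  have hfc (h : ℝ) : Continuous (f h) :=
    ((((hg.comp (continuous_id.add continuous_const)).sub hg).div_const _).abs).rpow_const
      fun _ => Or.inr hp
  have hfi (h x y : ℝ) : IntervalIntegrable (f h) volume x y := (hfc h).intervalIntegrable x y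
  have hf0 (h x : ℝ) : 0 ≤ f h x := Real.rpow_nonneg (abs_nonneg _) p
  set F : ℝ → ℝ → ℝ := fun h t => ∫ x in (0 : ℝ)..t, f h x with hF
  have hFsub (h x y : ℝ) : F h y - F h x = ∫ z in x..y, f h z :=
    intervalIntegral.integral_interval_sub_left (hfi h 0 y) (hfi h 0 x)
  have hmono (h : ℝ) : Monotone (F h) := fun x y hxy => by
    have := intervalIntegral.integral_nonneg (μ := volume) hxy fun z _ => hf0 h z
    rw [← hFsub] at this
    linarith
  have hlim (t : ℝ) : Tendsto (fun h => F h t) l (𝓝 (c * t)) := by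
    refine tendsto_of_monotone_of_tendsto_rat hmono (continuous_const.mul continuous_id)
      (fun q => ?_) t
    rcases le_total 0 q with hq | hq
    · simpa [hF, lpModulusIntegral] using h 0 q hq
    · have h1 := (h q 0 hq).neg
      have h2 : -(c * (((0 : ℚ) : ℝ) - q)) = c * q := by push_cast; ring
      rw [h2] at h1
      refine h1.congr fun z => ?_
      simp only [hF, lpModulusIntegral, Rat.cast_zero]
      exact (intervalIntegral.integral_symm _ _).symm
  have h3 := (hlim b).sub (hlim a)
  rw [← mul_sub] at h3
  exact h3.congr fun h => hFsub h a b

section FBM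
variable {Ω : Type*} [MeasurableSpace Ω] {P : Measure Ω} {r : ℝ} {G : ℝ → Ω → ℝ}

/-- Almost sure convergence along the lags `±n^(-k)`: the variances at these lags are of order
`n^(-k/2) + n^(-k(2-r)/2)`, which is summable under the two conditions on `k`. -/
lemma IsFractionalBrownianMotion.ae_tendsto_lpModulusIntegral_seq
    (hG : IsFractionalBrownianMotion P r G) (hr0 : 0 < r) (hr2 : r < 2)
    (hcont : ∀ ω, Continuous fun x => G x ω) (hmeas : ∀ x, Measurable (G x))
    {p a b s : ℝ} (hp : 1 ≤ p) (hab : a ≤ b) (hs : |s| = 1) {k : ℕ} (hk : 3 ≤ k)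
    (hkr : 2 < k * (2 - r)) :
    ∀ᵐ ω ∂P, Tendsto (fun n : ℕ => lpModulusIntegral (fun u => √(|u| ^ r)) (fun x => G x ω) a b p
      (s * ((n : ℝ) ^ k)⁻¹)) atTop (𝓝 (stdGaussianAbsMoment p * (b - a))) := by
  obtain ⟨C, hC⟩ := hG.exists_variance_lpModulusIntegral_le hr0 hr2 hcont hmeas hp hab
  have hs0 : s ≠ 0 := by rintro rfl; simp at hs
  set h : ℕ → ℝ := fun n => s * (((n + 1 : ℕ) : ℝ) ^ k)⁻¹ with hh
  have habs (n : ℕ) : |h n| = (((n + 1 : ℕ) : ℝ) ^ k)⁻¹ := by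
    rw [hh, abs_mul, hs, one_mul, abs_of_pos (by positivity)]
  have hh0 (n : ℕ) : h n ≠ 0 := mul_ne_zero hs0 (by positivity)
  have hh1 (n : ℕ) : |h n| ≤ 1 := by
    rw [habs]
    exact inv_le_one_of_one_le₀ (one_le_pow₀ (by simp))
  have hsqrt (n : ℕ) : √|h n| = ((n + 1 : ℕ) : ℝ) ^ (-(k / 2 : ℝ)) := by
    have hn : (0 : ℝ) ≤ ((n + 1 : ℕ) : ℝ) := by positivity
    rw [habs, Real.sqrt_eq_rpow, ← Real.rpow_natCast, ← Real.rpow_neg hn, ← Real.rpow_mul hn]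
    congr 1; ring
  have hsum : Summable fun n : ℕ => C * (√|h n| + √|h n| ^ (2 - r)) := by
    have hk' : (3 : ℝ) ≤ k := by exact_mod_cast hk
    have h1 : Summable fun n : ℕ => √|h n| := by
      simp_rw [hsqrt]
      exact (summable_nat_add_iff 1).mpr (Real.summable_nat_rpow.mpr (by linarith))
    have h2 : Summable fun n : ℕ => √|h n| ^ (2 - r) := by
      have (n : ℕ) : √|h n| ^ (2 - r) = ((n + 1 : ℕ) : ℝ) ^ (-(k / 2 : ℝ) * (2 - r)) := by
        rw [hsqrt, ← Real.rpow_mul (by positivity)]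
      simp_rw [this]
      exact (summable_nat_add_iff 1).mpr (Real.summable_nat_rpow.mpr (by linarith))
    exact (h1.add h2).mul_left C
  have hconv := ae_tendsto_zero_of_summable_integral
    (Y := fun n ω => (lpModulusIntegral (fun u => √(|u| ^ r)) (fun x => G x ω) a b p (h n)
      - stdGaussianAbsMoment p * (b - a)) ^ 2)
    (fun n ω => sq_nonneg _) (fun n => (hC _ (hh0 n) (hh1 n)).1)
    (Summable.of_nonneg_of_le (fun n => integral_nonneg fun ω => sq_nonneg _)
      (fun n => (hC _ (hh0 n) (hh1 n)).2) hsum)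
  filter_upwards [hconv] with ω hω
  rw [← tendsto_add_atTop_iff_nat 1]
  have h1 := hω.sqrt
  simp only [Real.sqrt_sq_eq_abs, Real.sqrt_zero] at h1
  have h2 := (tendsto_zero_iff_abs_tendsto_zero _).mpr h1
  simpa [hh] using h2.add_const (stdGaussianAbsMoment p * (b - a))

end FBM

theorem theorem2p3 {Ω : Type*} [MeasurableSpace Ω] (P : Measure Ω) [IsProbabilityMeasure P]
    (r : ℝ) (hr0 : 0 < r) (hr2 : r < 2) (G : ℝ → Ω → ℝ)
    (hG : IsFractionalBrownianMotion P r G) (p : ℝ) (hp : 1 ≤ p) :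
    ∀ᵐ ω ∂P, ∀ a b : ℝ,
      Tendsto (fun h : ℝ =>
          lpModulusIntegral (fun u : ℝ => Real.sqrt (|u| ^ r)) (fun x : ℝ => G x ω) a b p h)
        (𝓝[≠] 0)
        (𝓝 ((∫ y : ℝ, |y| ^ p ∂(gaussianReal 0 1)) * (b - a))) := by
  obtain ⟨H, hH, hcont, hmeas, hHG⟩ := hG.exists_measurable_continuous_version
  -- The lags `n^(-k)` must be sparse enough for the variances to be summable, and then a Hölder
  -- exponent `β < r / 2` with `(k + 1) β > k r / 2` controls the path between consecutive lags.
  obtain ⟨k, hk⟩ := exists_nat_gt (max 3 (2 / (2 - r)))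
  have hk3 : (3 : ℝ) < k := (le_max_left _ _).trans_lt hk
  have hk3' : 3 ≤ k := by exact_mod_cast hk3.le
  have hkr : 2 < k * (2 - r) := (div_lt_iff₀ (by linarith)).mp ((le_max_right _ _).trans_lt hk)
  have hklt : k * (r / 2) / (k + 1) < r / 2 := by
    rw [div_lt_iff₀ (by linarith)]; nlinarith
  obtain ⟨β, hβ1, hβ2⟩ := exists_between hklt
  have hβ0 : 0 < β := lt_of_le_of_lt (by positivity) hβ1
  have hkβ : k * (r / 2) < (k + 1) * β := by
    rw [div_lt_iff₀ (by linarith)] at hβ1; linarith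
  have hseq (s : ℝ) (hs : |s| = 1) : ∀ᵐ ω ∂P, ∀ a b : ℚ, a ≤ b → Tendsto (fun n : ℕ =>
      lpModulusIntegral (fun u => √(|u| ^ r)) (fun x => H x ω) a b p (s * ((n : ℝ) ^ k)⁻¹)) atTop
        (𝓝 (stdGaussianAbsMoment p * ((b : ℝ) - a))) := by
    simp only [ae_all_iff]
    exact fun a b hab => hH.ae_tendsto_lpModulusIntegral_seq hr0 hr2 hcont hmeas hp
      (by exact_mod_cast hab) hs hk3' hkr
  filter_upwards [hHG, hH.ae_exists_holder hβ0 hβ2, hseq 1 (by simp), hseq (-1) (by simp)]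
    with ω hω hhol hpos hneg a b
  have hωf : (fun x => G x ω) = fun x => H x ω := funext fun x => (hω x).symm
  rw [hωf]
  change Tendsto _ _ (𝓝 (stdGaussianAbsMoment p * (b - a)))
  refine tendsto_lpModulusIntegral_of_rat (hcont ω) (by linarith) (fun a b hab => ?_) a b
  have hab' : (a : ℝ) ≤ b := by exact_mod_cast hab
  have hside (s : ℝ) (hs : |s| = 1) := tendsto_lpModulusIntegral_of_tendsto_seq (hcont ω)
    (r := r) (p := p) (c := stdGaussianAbsMoment p * ((b : ℝ) - a)) hab' hs hp (by omega)
    hβ0 hkβ hhol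
  rw [← nhdsLT_sup_nhdsGT, tendsto_sup]
  constructor
  · have h1 := hside (-1) (by simp) (hneg a b hab)
    have h2 : Tendsto (fun h : ℝ => -h) (𝓝[<] 0) (𝓝[>] 0) := by
      simpa using tendsto_neg_nhdsLT (a := (0 : ℝ))
    simpa [Function.comp_def] using h1.comp h2
  · simpa using hside 1 (by simp) (hpos a b hab)
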